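/- Let $E$ be a finite set and $\mathbb T=\mathbb R\cup\{\infty\}$. A valuated matroid $\mu$ on $E$ with underlying matroid $M$ is a function $\mu$ from the subsets of $E$ to $\mathbb T$ which is finite exactly on the bases of $M$ and such that for all bases $B,B'$ of $M$ and $i\in B\setminus B'$ there is $j\in B'\setminus B$ with $\mu(B)+\mu(B')\ge \mu((B\setminus i)\cup j)+\mu((B'\setminus j)\cup i)$. If $\mu,\nu$ are valuated matroids on $E$ with underlying matroids $M,N$, then $\mu$ is a (valuated) quotient of $\nu$, written $\mu\twoheadleftarrow\nu$ or $\nu\twoheadrightarrow\mu$, if $\operatorname{rk}M\le\operatorname{rk}N$ and for every basis $I$ of $M$, every basis $J$ of $N$ and every $i\in I\setminus J$ there is $j\in J\setminus I$ with $\mu(I)+\nu(J)\ge\mu((I\setminus i)\cup j)+\nu((J\setminus j)\cup i)$. For $S\subseteq E$, the contraction $\mu/S$ is the valuated matroid on $E\setminus S$ with underlying matroid $M/S$ given by $(\mu/S)(I)=\mu(I\cup K)$, where $K$ is a fixed basis of $S$ in $M$; the deletion $\mu\setminus S$ is the valuated matroid on $E\setminus S$ with underlying matroid $M\setminus S$ given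 by $(\mu\setminus S)(I)=\mu(I\cup L)$, where $L$ is a fixed basis of $M/(E\setminus S)$. Other choices of $K$ and $L$ change these functions only by a global additive constant, which does not affect the notion of quotient. A matroid $M$ on $E$ is a quotient of a matroid $N$ on $E$, written $M\twoheadleftarrow N$, if $\operatorname{rk}_M(B)-\operatorname{rk}_M(A)\le\operatorname{rk}_N(B)-\operatorname{rk}_N(A)$ for all $A\subseteq B\subseteq E$. Corollary. Let $\mu,\nu,\xi$ be valuated matroids on $E$, and let $M,N$ be the underlying matroids of $\mu,\nu$. 1. If $\mu\twoheadrightarrow\nu$ and $\nu\twoheadrightarrow\xi$, then $\mu\twoheadrightarrow\xi$. 2. If $\mu\twoheadleftarrow\nu$, then $\mu/S\twoheadleftarrow\nu/S$ and $\mu\setminus S\twoheadleftarrow\nu\setminus S$ for every $S\subseteq E$. 3. For every $S\subseteq E$, $\mu/S\twoheadleftarrow\mu\setminus S$. 4. If $\mu\twoheadleftarrow\nu$, then $M\twoheadleftarrow N$. -/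

import Mathlib

open Set

/-- The rank function of a matroid on a finite ground set, as an integer. -/
noncomputable def Matroid.intRk {α : Type*} (M : Matroid α) (X : Set α) : ℤ :=
  ((M.eRk X).toNat : ℤ)

/-- `M.IsQuotientOf N`: the matroid `M` is a quotient of the matroid `N` on the same ground set,
that is `rk_M(B) - rk_M(A) ≤ rk_N(B) - rk_N(A)` for all `A ⊆ B ⊆ E`.
(Used for matroids on a finite ground set.) -/
def Matroid.IsQuotientOf {α : Type*} (M N : Matroid α) : Prop :=
  M.E = N.E ∧ ∀ A B : Set α, A ⊆ B → B ⊆ M.E →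
    M.intRk B - M.intRk A ≤ N.intRk B - N.intRk A

/-- A valuated matroid on a finite ground set `E = matroid.E`, seen as a function with values in the
tropical semifield `𝕋 = ℝ ∪ {∞}` that is finite exactly on the bases of its underlying matroid. -/
structure ValuatedMatroid (α : Type*) where
  /-- The underlying matroid. -/
  matroid : Matroid α
  /-- The ground set is finite. -/
  finite_ground : matroid.E.Finite
  /-- The valuation. -/
  val : Set α → WithTop ℝ
  val_ne_top_iff : ∀ B, val B ≠ ⊤ ↔ matroid.IsBase B
  exchange : ∀ B B', matroid.IsBase B → matroid.IsBase B' → ∀ i ∈ B \ B', ∃ j ∈ B' \ B,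
    val (insert j (B \ {i})) + val (insert i (B' \ {j})) ≤ val B + val B'

/-- If `K` is a basis of `S` in `M`, the bases of `M / S` are the sets `I` disjoint from `S` such
that `I ∪ K` is a basis of `M`. -/
theorem Matroid.IsBasis'.isBase_contract_iff {α : Type*} {M : Matroid α} {K S : Set α}
    (hK : M.IsBasis' K S) (I : Set α) :
    (M.contract S).IsBase I ↔ Disjoint I S ∧ M.IsBase (I ∪ K) := by
  have hmax : ∀ J, M.Indep J → K ⊆ J → J ∩ S = K := by
    intro J hJ hKJ
    exact (hK.eq_of_subset_indep (hJ.subset inter_subset_left)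
      (subset_inter hKJ hK.subset) inter_subset_right).symm
  constructor
  · intro hI
    obtain ⟨hIK, hdisj⟩ := hK.contract_indep_iff.1 hI.indep
    obtain ⟨B, hB, hIB⟩ := hIK.exists_isBase_superset
    have hBS : B ∩ S = K := hmax B hB.indep (subset_union_right.trans hIB)
    have hBK : (B \ S) ∪ K = B := by rw [← hBS, sdiff_union_inter]
    have hind : (M.contract S).Indep (B \ S) :=
      hK.contract_indep_iff.2 ⟨by rw [hBK]; exact hB.indep, disjoint_sdiff_right⟩
    have hIBS : I ⊆ B \ S := fun x hx ↦
      ⟨hIB (Or.inl hx), fun hxS ↦ (disjoint_left.1 hdisj) hxS hx⟩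
    have := hI.eq_of_subset_indep hind hIBS
    refine ⟨hdisj.symm, ?_⟩
    rw [this, hBK]
    exact hB
  · rintro ⟨hdisj, hB⟩
    rw [Matroid.isBase_iff_maximal_indep]
    refine ⟨hK.contract_indep_iff.2 ⟨hB.indep, hdisj.symm⟩, ?_⟩
    intro J hJ hIJ x hx
    obtain ⟨hJK, hJS⟩ := hK.contract_indep_iff.1 hJ
    have := hB.eq_of_subset_indep hJK (union_subset_union_left K hIJ)
    have hx' : x ∈ I ∪ K := by rw [this]; exact Or.inl hx
    rcases hx' with h | h
    · exact h
    · exact absurd hx ((disjoint_left.1 hJS) (hK.subset h))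

/-- If `L` is a basis of `M / (E \ S)`, the bases of `M \ S` are the sets `I` disjoint from `S` such
that `I ∪ L` is a basis of `M`. -/
theorem Matroid.isBase_delete_iff_of_isBase_contract {α : Type*} {M : Matroid α} {L S : Set α}
    (hL : (M.contract (M.E \ S)).IsBase L) (I : Set α) :
    (M.delete S).IsBase I ↔ Disjoint I S ∧ M.IsBase (I ∪ L) := by
  rw [Matroid.delete_isBase_iff]
  constructor
  · intro hI
    have h := (hI.isBasis'.isBase_contract_iff L).1 hL
    refine ⟨disjoint_left.2 fun x hx ↦ (hI.subset hx).2, ?_⟩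
    rw [union_comm]
    exact h.2
  · rintro ⟨hdisj, hB⟩
    have hsub : I ⊆ M.E \ S := fun x hx ↦
      ⟨hB.subset_ground (Or.inl hx), disjoint_left.1 hdisj hx⟩
    obtain ⟨I', hI', hII'⟩ := (hB.indep.subset subset_union_left).subset_isBasis_of_subset hsub
    obtain ⟨hd, hB'⟩ := (hI'.isBasis'.isBase_contract_iff L).1 hL
    have heq := hB.eq_of_subset_isBase hB' (by
      rw [union_comm]; exact union_subset_union_right L hII')
    have : I' ⊆ I := by
      intro x hx
      have hx' : x ∈ I ∪ L := by rw [heq]; exact Or.inr hx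
      exact hx'.resolve_right fun h ↦ disjoint_left.1 hd h (hI'.subset hx)
    rw [subset_antisymm hII' this]
    exact hI'

namespace ValuatedMatroid

variable {α : Type*}

/-- The ground set. -/
def E (μ : ValuatedMatroid α) : Set α := μ.matroid.E

/-- `μ.IsQuotient ν`: the valuated matroid `μ` is a valuated quotient of `ν`. -/
def IsQuotient (μ ν : ValuatedMatroid α) : Prop :=
  μ.E = ν.E ∧ μ.matroid.eRank ≤ ν.matroid.eRank ∧
    ∀ I J, μ.matroid.IsBase I → ν.matroid.IsBase J → ∀ i ∈ I \ J, ∃ j ∈ J \ I,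
      μ.val (insert j (I \ {i})) + ν.val (insert i (J \ {j})) ≤ μ.val I + ν.val J

open Classical in
/-- The valuated matroid `I ↦ μ (I ∪ K)` on the subsets `I` disjoint from `S`, where `K ⊆ S` is a
fixed set, with underlying matroid `N`. -/
noncomputable def slice (μ : ValuatedMatroid α) (S K : Set α) (N : Matroid α) (hKS : K ⊆ S)
    (hE : N.E ⊆ μ.matroid.E)
    (hN : ∀ I, N.IsBase I ↔ Disjoint I S ∧ μ.matroid.IsBase (I ∪ K)) : ValuatedMatroid α where
  matroid := N
  finite_ground := μ.finite_ground.subset hE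
  val I := if Disjoint I S then μ.val (I ∪ K) else ⊤
  val_ne_top_iff I := by
    rw [hN]
    split_ifs with h
    · simp [h, μ.val_ne_top_iff]
    · simp [h]
  exchange I I' hI hI' i hi := by
    obtain ⟨hd, hB⟩ := (hN I).1 hI
    obtain ⟨hd', hB'⟩ := (hN I').1 hI'
    have hiS : i ∉ S := disjoint_left.1 hd hi.1
    have hiK : i ∉ K := fun h ↦ hiS (hKS h)
    obtain ⟨j, hj, hle⟩ := μ.exchange _ _ hB hB' i
      ⟨Or.inl hi.1, fun h ↦ h.elim hi.2 hiK⟩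
    have hjK : j ∉ K := fun h ↦ hj.2 (Or.inr h)
    have hjI' : j ∈ I' := hj.1.resolve_right hjK
    have hjS : j ∉ S := disjoint_left.1 hd' hjI'
    refine ⟨j, ⟨hjI', fun h ↦ hj.2 (Or.inl h)⟩, ?_⟩
    have h1 : Disjoint (insert j (I \ {i})) S :=
      disjoint_insert_left.2 ⟨hjS, hd.mono_left sdiff_subset⟩
    have h2 : Disjoint (insert i (I' \ {j})) S :=
      disjoint_insert_left.2 ⟨hiS, hd'.mono_left sdiff_subset⟩
    rw [if_pos h1, if_pos h2, if_pos hd, if_pos hd', insert_union, insert_union]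
    rwa [union_sdiff_distrib, union_sdiff_distrib, sdiff_singleton_eq_self hiK,
      sdiff_singleton_eq_self hjK] at hle

/-- The contraction `μ / S`: a valuated matroid on `E \ S` with underlying matroid `M / S`, given by
`(μ / S)(I) = μ(I ∪ K)` for a basis `K` of `S` in `M`. Another choice of `K` changes it only by a
global additive constant. -/
noncomputable def contract (μ : ValuatedMatroid α) (S : Set α) : ValuatedMatroid α :=
  μ.slice S (μ.matroid.exists_isBasis' S).choose (μ.matroid.contract S)
    (μ.matroid.exists_isBasis' S).choose_spec.subset sdiff_subset
    (μ.matroid.exists_isBasis' S).choose_spec.isBase_contract_iff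

/-- The deletion `μ \ S`, which is also the restriction of `μ` to `E \ S`: a valuated matroid on
`E \ S` with underlying matroid `M \ S`, given by `(μ \ S)(I) = μ(I ∪ L)` for a basis `L` of
`M / (E \ S)`. Another choice of `L` changes it only by a global additive constant. -/
noncomputable def delete (μ : ValuatedMatroid α) (S : Set α) : ValuatedMatroid α :=
  μ.slice S (μ.matroid.contract (μ.matroid.E \ S)).exists_isBase.choose (μ.matroid.delete S)
    (fun _ hx ↦ by_contra fun hxS ↦
      have h := (μ.matroid.contract (μ.matroid.E \ S)).exists_isBase.choose_spec.subset_ground hx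
      h.2 ⟨h.1, hxS⟩)
    sdiff_subset
    (Matroid.isBase_delete_iff_of_isBase_contract
      (μ.matroid.contract (μ.matroid.E \ S)).exists_isBase.choose_spec)

theorem slice_step (μ : ValuatedMatroid α) {S K K' L L' : Set α} {i j : α}
    (hK : μ.matroid.IsBasis' K S) (hK' : μ.matroid.IsBasis' K' S)
    (hL : (μ.matroid.contract S).IsBase L) (hL' : (μ.matroid.contract S).IsBase L')
    (hi : i ∈ L) (hj : j ∉ L) (h : L' = insert j (L \ {i})) (hi' : i ∉ L') :
    μ.val (L' ∪ K) + μ.val (L ∪ K') ≤ μ.val (L ∪ K) + μ.val (L' ∪ K') := by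
  obtain ⟨hd, hB⟩ := (hK.isBase_contract_iff L).1 hL
  obtain ⟨hd', hB'⟩ := (hK'.isBase_contract_iff L').1 hL'
  have hiS : i ∉ S := disjoint_left.1 hd hi
  have hiK : i ∉ K := fun h ↦ hiS (hK.subset h)
  have hiK' : i ∉ K' := fun h ↦ hiS (hK'.subset h)
  have hjL' : j ∈ L' := by rw [h]; exact Or.inl rfl
  have hjS : j ∉ S := disjoint_left.1 hd' hjL'
  obtain ⟨k, hk, hle⟩ := μ.exchange _ _ hB hB' i ⟨Or.inl hi, fun h ↦ h.elim hi' hiK'⟩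
  have htop : μ.val (insert k ((L ∪ K) \ {i})) ≠ ⊤ := by
    intro ht
    rw [ht, top_add, top_le_iff, WithTop.add_eq_top] at hle
    exact hle.elim ((μ.val_ne_top_iff _).2 hB) ((μ.val_ne_top_iff _).2 hB')
  have hkb := ((μ.val_ne_top_iff _).1 htop).indep
  have hkK' : k ∉ K' := by
    intro hkK'
    have hsub : insert k K ⊆ insert k ((L ∪ K) \ {i}) := insert_subset_insert fun x hx ↦
      ⟨Or.inr hx, fun hxi ↦ hiK (hxi ▸ hx)⟩
    have := hK.eq_of_subset_indep (hkb.subset hsub) (subset_insert _ _)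
      (insert_subset (hK'.subset hkK') hK.subset)
    exact hk.2 (Or.inr (this ▸ mem_insert k K))
  have hkj : k = j := by
    have hkL' := hk.1.resolve_right hkK'
    rw [h] at hkL'
    exact hkL'.resolve_right fun hx ↦ hk.2 (Or.inl hx.1)
  subst hkj
  have e1 : insert k ((L ∪ K) \ {i}) = L' ∪ K := by
    rw [h, insert_union, union_sdiff_distrib, sdiff_singleton_eq_self hiK]
  have e2 : insert i ((L' ∪ K') \ {k}) = L ∪ K' := by
    rw [union_sdiff_distrib, sdiff_singleton_eq_self hkK', h,
      insert_sdiff_self_of_notMem (fun hx ↦ hj hx.1), ← insert_union,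
      insert_sdiff_singleton, insert_eq_of_mem hi]
  rwa [e1, e2] at hle

/-- The values `μ (L ∪ K)`, for `K` a basis of `S` and `L` a basis of `M / S`, split as a sum of a
function of `K` and a function of `L`. -/
theorem val_add_val (μ : ValuatedMatroid α) {S K K' L' : Set α}
    (hK : μ.matroid.IsBasis' K S) (hK' : μ.matroid.IsBasis' K' S)
    (hL' : (μ.matroid.contract S).IsBase L') (n : ℕ) :
    ∀ L, (μ.matroid.contract S).IsBase L → (L \ L').ncard = n →
      μ.val (L ∪ K) + μ.val (L' ∪ K') = μ.val (L' ∪ K) + μ.val (L ∪ K') := by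
  induction n with
  | zero =>
    intro L hL h0
    have hfin : (L \ L').Finite :=
      μ.finite_ground.subset fun x hx ↦ (hL.subset_ground hx.1).1
    rw [Set.ncard_eq_zero hfin, sdiff_eq_empty] at h0
    rw [hL.eq_of_subset_isBase hL' h0]
  | succ n ih =>
    intro L hL hn
    have hfin : (L \ L').Finite :=
      μ.finite_ground.subset fun x hx ↦ (hL.subset_ground hx.1).1
    obtain ⟨i, hi⟩ : (L \ L').Nonempty := by
      rw [nonempty_iff_ne_empty]; rintro h; simp [h] at hn
    obtain ⟨j, hj, hL1⟩ := hL.exchange hL' hi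
    have hij : i ≠ j := fun h ↦ hj.2 (h ▸ hi.1)
    have hi1 : i ∉ insert j (L \ {i}) := by simp [hij]
    have hcard : (insert j (L \ {i}) \ L').ncard = n := by
      have : insert j (L \ {i}) \ L' = (L \ L') \ {i} := by
        ext x
        simp only [mem_sdiff, mem_insert_iff, mem_singleton_iff]
        constructor
        · rintro ⟨rfl | h, h'⟩
          · exact absurd hj.1 h'
          · exact ⟨⟨h.1, h'⟩, h.2⟩
        · rintro ⟨⟨h, h'⟩, h''⟩
          exact ⟨Or.inr ⟨h, h''⟩, h'⟩
      rw [this, Set.ncard_sdiff_singleton_of_mem hi, hn]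
      rfl
    have h1 := ih _ hL1 hcard
    have h2 := μ.slice_step hK hK' hL hL1 hi.1 hj.2 rfl hi1
    have h3 := μ.slice_step hK' hK hL hL1 hi.1 hj.2 rfl hi1
    have key : ∀ {X P}, μ.matroid.IsBasis' P S → (μ.matroid.contract S).IsBase X →
        ∃ r : ℝ, μ.val (X ∪ P) = r := fun hP hX ↦
      ⟨_, (WithTop.coe_untop _
        ((μ.val_ne_top_iff _).2 ((hP.isBase_contract_iff _).1 hX).2)).symm⟩
    obtain ⟨a, ha⟩ := key hK hL
    obtain ⟨b, hb⟩ := key hK' hL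
    obtain ⟨c, hc⟩ := key hK hL1
    obtain ⟨d, hd⟩ := key hK' hL1
    obtain ⟨e, he⟩ := key hK hL'
    obtain ⟨f, hf⟩ := key hK' hL'
    rw [hc, hd, he, hf] at h1
    rw [ha, hb, hc, hd] at h2 h3
    rw [ha, hb, he, hf]
    norm_cast at h1 h2 h3 ⊢
    linarith

/-- The characterization of restriction and contraction through the face of `μ` on which
`∑_{i ∉ S} x_i` is minimal: on the bases in this face, `μ` is the sum of its restriction to `S` and
its contraction by `S`, up to a global additive constant. -/
theorem val_eq_restrict_add_contract (μ : ValuatedMatroid α) (S : Set α) (hS : S ⊆ μ.E) :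
    ∃ c : ℝ, ∀ B, μ.matroid.IsBase B →
      (∀ B', μ.matroid.IsBase B' → (B \ S).ncard ≤ (B' \ S).ncard) →
      μ.val B = (μ.delete (μ.E \ S)).val (B ∩ S) + (μ.contract S).val (B \ S) + c := by
  have hES : μ.matroid.E \ (μ.E \ S) = S := sdiff_sdiff_cancel_left hS
  obtain ⟨K₀, hK₀, hcv⟩ : ∃ K₀, μ.matroid.IsBasis' K₀ S ∧
      ∀ I, Disjoint I S → (μ.contract S).val I = μ.val (I ∪ K₀) :=
    ⟨_, (μ.matroid.exists_isBasis' S).choose_spec, fun I hI ↦ if_pos hI⟩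
  obtain ⟨L₀, hL₀, hdv⟩ : ∃ L₀, (μ.matroid.contract S).IsBase L₀ ∧
      ∀ I, Disjoint I (μ.E \ S) → (μ.delete (μ.E \ S)).val I = μ.val (I ∪ L₀) := by
    obtain ⟨L, hL, hv⟩ : ∃ L, (μ.matroid.contract (μ.matroid.E \ (μ.E \ S))).IsBase L ∧
        ∀ I, Disjoint I (μ.E \ S) → (μ.delete (μ.E \ S)).val I = μ.val (I ∪ L) :=
      ⟨_, Exists.choose_spec _, fun I hI ↦ if_pos hI⟩
    rw [hES] at hL
    exact ⟨L, hL, hv⟩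
  have key : ∀ {X P}, μ.matroid.IsBasis' P S → (μ.matroid.contract S).IsBase X →
      ∃ r : ℝ, μ.val (X ∪ P) = r := fun hP hX ↦
    ⟨_, (WithTop.coe_untop _
      ((μ.val_ne_top_iff _).2 ((hP.isBase_contract_iff _).1 hX).2)).symm⟩
  obtain ⟨c, hc⟩ := key hK₀ hL₀
  refine ⟨-c, fun B hB hmin ↦ ?_⟩
  have hBS : μ.matroid.IsBasis' (B ∩ S) S := by
    obtain ⟨K, hK, hBK⟩ := (hB.indep.subset inter_subset_left).subset_isBasis'_of_subset
      (inter_subset_right (s := B) (t := S))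
    obtain ⟨B', hB', hKB', hB'u⟩ := hK.indep.exists_isBase_subset_union_isBase hB
    have hf : ∀ {X : Set α}, μ.matroid.IsBase X → X.Finite := fun hX ↦
      μ.finite_ground.subset hX.subset_ground
    have hsub : B' \ S ⊆ B \ S := fun x hx ↦
      ⟨(hB'u hx.1).resolve_left fun h ↦ hx.2 (hK.subset h), hx.2⟩
    have heq : B' \ S = B \ S :=
      Set.eq_of_subset_of_ncard_le hsub (hmin B' hB') (hf hB).sdiff
    have hBB' : B = B' := hB.eq_of_subset_isBase hB' fun x hx ↦ by
      by_cases hxS : x ∈ S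
      · exact hKB' (hBK ⟨hx, hxS⟩)
      · have : x ∈ B' \ S := by rw [heq]; exact ⟨hx, hxS⟩
        exact this.1
    have : B ∩ S = K := subset_antisymm hBK (subset_inter (by rw [hBB']; exact hKB') hK.subset)
    rwa [this]
  have hdisj : Disjoint (B \ S) S := disjoint_sdiff_left
  have hL : (μ.matroid.contract S).IsBase (B \ S) :=
    (hBS.isBase_contract_iff _).2 ⟨hdisj, by rwa [sdiff_union_inter]⟩
  have h := μ.val_add_val hBS hK₀ hL₀ _ _ hL rfl
  rw [hcv _ hdisj, hdv _ (disjoint_left.2 fun x hx hx' ↦ hx'.2 hx.2), union_comm (B ∩ S) L₀]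
  obtain ⟨p, hp⟩ := key hBS hL
  obtain ⟨q, hq⟩ := key hBS hL₀
  obtain ⟨r, hr⟩ := key hK₀ hL
  rw [hp, hq, hr, hc] at h
  rw [hq, hr]
  rw [sdiff_union_inter] at hp
  rw [hp]
  norm_cast at h ⊢
  linarith

end ValuatedMatroid

/-!
The exchange condition in the definition of a quotient makes sense for arbitrary functions
`f, g : Set α → WithTop Γ`, and most of the argument takes place at that level.

*Composition.* Suppose exchange holds from `f` to `g` and from `g` to `h`, and let `f I` be finite
and `i ∈ I`. Minimize `g B - ∑ b ∈ B, f (I - i + b)` over the support of `g`, counting a summand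
with `b ∈ I - i` as `⊤`. Exchange from `f` to `g` gives a minimizer `B` containing `i`, and moving
from this `B` to `B - i + k` costs at least as much in `g` as moving from `I` to `I - i + k` does
in `f`. Hence an exchange of `i` from `B` through `h` can be performed from `I`. Infinite values of
`f` are handled by working in `ℤ ×ₗ Γ`, where `⊤` becomes an element larger than all of `Γ`.

*Minors.* A minor of `f` is `I ↦ f (I ∪ K)`, where `K` is a maximal (for contraction) or minimal
(for deletion) trace on `S` of a set in the support of `f`. Extremality forbids an exchange that
would touch `S`.

*Underlying matroids.* An element `e ∉ X` lies in the closure of `X` exactly when it is a loop of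
the contraction by `X`, and exchange cannot move a loop of `N / X` into a basis. Hence closures in
`N` are contained in closures in `M`, which gives the inequality for ranks.
-/

section OrderedGroup

variable {α Λ : Type*} [AddCommGroup Λ]

theorem finsum_mem_exchange (w : α → Λ) {B : Set α} (hB : B.Finite) {j k : α} (hj : j ∉ B)
    (hk : k ∈ B) : ∑ᶠ b ∈ insert j (B \ {k}), w b = ∑ᶠ b ∈ B, w b + w j - w k := by
  rw [finsum_mem_insert w (fun h ↦ hj h.1) hB.sdiff,
    ← finsum_mem_add_sdiff (f := w) (singleton_subset_iff.2 hk) hB, finsum_mem_singleton]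
  abel

variable [LinearOrder Λ] [IsOrderedAddMonoid Λ]

theorem exists_mem_forall_exchange_le {𝓑 : Set (Set α)} (h𝓑 : 𝓑.Finite) (hne : 𝓑.Nonempty)
    (hfin : ∀ B ∈ 𝓑, B.Finite) (v : Set α → Λ) (w : α → Λ) {i : α}
    (hi : ∀ B ∈ 𝓑, i ∉ B →
      ∃ k ∈ B, insert i (B \ {k}) ∈ 𝓑 ∧ w k + v (insert i (B \ {k})) ≤ w i + v B) :
    ∃ B ∈ 𝓑, i ∈ B ∧
      ∀ k ∉ B, insert k (B \ {i}) ∈ 𝓑 → w k + v B ≤ w i + v (insert k (B \ {i})) := by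
  let φ : Set α → Λ := fun B ↦ v B - ∑ᶠ b ∈ B, w b
  have hφ {B : Set α} (hB : B ∈ 𝓑) {j k : α} (hj : j ∉ B) (hk : k ∈ B) :
      φ (insert j (B \ {k})) - φ B = (w k + v (insert j (B \ {k}))) - (w j + v B) := by
    simp only [φ, finsum_mem_exchange w (hfin B hB) hj hk]
    abel
  obtain ⟨B₀, hB₀⟩ := h𝓑.exists_minimalFor φ 𝓑 hne
  have hB₀_le {B : Set α} (hB : B ∈ 𝓑) : φ B₀ ≤ φ B :=
    (le_total (φ B₀) (φ B)).elim id (hB₀.2 hB)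
  obtain ⟨B, hB, hiB, hBmin⟩ : ∃ B ∈ 𝓑, i ∈ B ∧ φ B ≤ φ B₀ := by
    by_cases hiB₀ : i ∈ B₀
    · exact ⟨B₀, hB₀.1, hiB₀, le_rfl⟩
    · obtain ⟨k, hk, hB, hle⟩ := hi B₀ hB₀.1 hiB₀
      exact ⟨_, hB, mem_insert _ _, sub_nonpos.1 (hφ hB₀.1 hiB₀ hk ▸ sub_nonpos.2 hle)⟩
  refine ⟨B, hB, hiB, fun k hk hB' ↦ ?_⟩
  have hle := sub_nonneg.2 (hBmin.trans (hB₀_le hB'))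
  rwa [hφ hB hk hiB, sub_nonneg] at hle

end OrderedGroup

section LexOfWithTop

variable {Γ : Type*} [AddCommGroup Γ]

/-- The embedding of `WithTop Γ` into the group `ℤ ×ₗ Γ` that sends `⊤` to `(1, 0)`, an element
larger than all of `Γ`. It makes sums of possibly infinite values invertible. -/
def lexOfWithTop : WithTop Γ → ℤ ×ₗ Γ :=
  WithTop.recTopCoe (toLex (1, 0)) fun a ↦ toLex (0, a)

theorem lexOfWithTop_add_le_iff [LinearOrder Γ] {a b c d : WithTop Γ} (hb : b ≠ ⊤) (hc : c ≠ ⊤)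
    (hd : d ≠ ⊤) : lexOfWithTop a + lexOfWithTop b ≤ lexOfWithTop c + lexOfWithTop d ↔
      a + b ≤ c + d := by
  lift b to Γ using hb
  lift c to Γ using hc
  lift d to Γ using hd
  induction a with
  | top => simp [lexOfWithTop, Prod.Lex.le_iff, ← WithTop.coe_add]
  | coe a => simp [lexOfWithTop, Prod.Lex.le_iff, ← WithTop.coe_add]

end LexOfWithTop

/-- Every element of `I \ J` can be exchanged for one of `J \ I` without increasing `f I + g J`,
whenever `f I` and `g J` are finite. With `f = g` this is the exchange axiom of valuated matroids,
and in general the one of valuated quotients. -/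
def QuotientExchange {α Γ : Type*} [Add Γ] [LE Γ] (f g : Set α → WithTop Γ) : Prop :=
  ∀ I J, f I ≠ ⊤ → g J ≠ ⊤ → ∀ i ∈ I \ J, ∃ j ∈ J \ I,
    f (insert j (I \ {i})) + g (insert i (J \ {j})) ≤ f I + g J

open Classical in
/-- The function `I ↦ f (I ∪ K)` on the sets `I` disjoint from `S`, extended by `⊤`. Contraction and
deletion of `S` are the cases where `K` is a maximal, respectively minimal, trace of `f` on `S`. -/
noncomputable def sliceVal {α Γ : Type*} (f : Set α → WithTop Γ) (S K : Set α) :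
    Set α → WithTop Γ :=
  fun I ↦ if Disjoint I S then f (I ∪ K) else ⊤

theorem sliceVal_of_disjoint {α Γ : Type*} (f : Set α → WithTop Γ) {S I : Set α} (K : Set α)
    (hI : Disjoint I S) : sliceVal f S K I = f (I ∪ K) :=
  if_pos hI

theorem sliceVal_ne_top_iff {α Γ : Type*} {f : Set α → WithTop Γ} {S K I : Set α} :
    sliceVal f S K I ≠ ⊤ ↔ Disjoint I S ∧ f (I ∪ K) ≠ ⊤ := by
  unfold sliceVal
  split_ifs with h <;> simp [h]

theorem sliceVal_insert_sdiff_singleton {α Γ : Type*} (f : Set α → WithTop Γ) {S K I : Set α}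
    {i j : α} (hKS : K ⊆ S) (hI : Disjoint I S) (hi : i ∉ S) (hj : j ∉ S) :
    sliceVal f S K (insert j (I \ {i})) = f (insert j ((I ∪ K) \ {i})) := by
  rw [sliceVal_of_disjoint f K (disjoint_insert_left.2 ⟨hj, hI.mono_left sdiff_subset⟩),
    insert_union, union_sdiff_distrib, sdiff_singleton_eq_self fun h ↦ hi (hKS h)]

/-- The traces on `S` of `f`: the intersections with `S` of the sets on which `f` is finite. -/
def traces {α Γ : Type*} (f : Set α → WithTop Γ) (S : Set α) : Set (Set α) :=
  (· ∩ S) '' {B | f B ≠ ⊤}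

namespace QuotientExchange

variable {α Γ : Type*}

theorem exists_exchange_ne_top [Add Γ] [PartialOrder Γ] {f g : Set α → WithTop Γ}
    (hfg : QuotientExchange f g) {I J : Set α} (hI : f I ≠ ⊤) (hJ : g J ≠ ⊤) {i : α}
    (hi : i ∈ I \ J) :
    ∃ j ∈ J \ I, f (insert j (I \ {i})) ≠ ⊤ ∧ g (insert i (J \ {j})) ≠ ⊤ ∧
      f (insert j (I \ {i})) + g (insert i (J \ {j})) ≤ f I + g J := by
  obtain ⟨j, hj, hle⟩ := hfg I J hI hJ i hi
  have hne := WithTop.add_ne_top.1 (ne_top_of_le_ne_top (WithTop.add_ne_top.2 ⟨hI, hJ⟩) hle)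
  exact ⟨j, hj, hne.1, hne.2, hle⟩

theorem sliceVal [Add Γ] [PartialOrder Γ] {f g : Set α → WithTop Γ} (hfg : QuotientExchange f g)
    {S K L : Set α} (hKS : K ⊆ S) (hLS : L ⊆ S)
    (hKL : Maximal (· ∈ traces f S) K ∨ Minimal (· ∈ traces g S) L) :
    QuotientExchange (sliceVal f S K) (sliceVal g S L) := by
  intro I J hI hJ i hi
  obtain ⟨hIS, hIK⟩ := sliceVal_ne_top_iff.1 hI
  obtain ⟨hJS, hJL⟩ := sliceVal_ne_top_iff.1 hJ
  have hiS : i ∉ S := hIS.notMem_of_mem_left hi.1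
  have hi' : i ∈ (I ∪ K) \ (J ∪ L) := ⟨.inl hi.1, not_or.2 ⟨hi.2, fun h ↦ hiS (hLS h)⟩⟩
  obtain ⟨j, ⟨hjJL, hjIK⟩, hfj, hgj, hle⟩ := hfg.exists_exchange_ne_top hIK hJL hi'
  have hjL : j ∉ L := by
    intro hjL
    rcases hKL with hK | hL
    · have hKB : K ⊆ insert j ((I ∪ K) \ {i}) ∩ S := fun x hx ↦
        ⟨.inr ⟨.inr hx, fun h ↦ hiS (h ▸ hKS hx)⟩, hKS hx⟩
      exact hjIK (.inr (hK.2 ⟨_, hfj, rfl⟩ hKB ⟨mem_insert _ _, hLS hjL⟩))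
    · have hBL : insert i ((J ∪ L) \ {j}) ∩ S ⊆ L := by
        rintro x ⟨rfl | ⟨hx | hx, -⟩, hxS⟩
        exacts [absurd hxS hiS, absurd hxS (hJS.notMem_of_mem_left hx), hx]
      rcases (hL.2 ⟨_, hgj, rfl⟩ hBL hjL).1 with rfl | ⟨-, hjj⟩
      exacts [hiS (hLS hjL), hjj rfl]
  have hjJ : j ∈ J := hjJL.resolve_right hjL
  have hjS : j ∉ S := hJS.notMem_of_mem_left hjJ
  refine ⟨j, ⟨hjJ, fun h ↦ hjIK (.inl h)⟩, ?_⟩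
  rwa [sliceVal_insert_sdiff_singleton f hKS hIS hiS hjS,
    sliceVal_insert_sdiff_singleton g hLS hJS hjS hiS, sliceVal_of_disjoint f K hIS,
    sliceVal_of_disjoint g L hJS]

variable [AddCommGroup Γ] [LinearOrder Γ] [IsOrderedAddMonoid Γ] {f g h : Set α → WithTop Γ}

theorem exists_forall_exchange_le (hfg : QuotientExchange f g) (hg : {B | g B ≠ ⊤}.Finite)
    (hne : {B | g B ≠ ⊤}.Nonempty) (hfin : ∀ B, g B ≠ ⊤ → B.Finite) {I : Set α} (hI : f I ≠ ⊤)
    {i : α} (hi : i ∈ I) :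
    ∃ B, g B ≠ ⊤ ∧ i ∈ B ∧ ∀ k ∉ B, g (insert k (B \ {i})) ≠ ⊤ →
      k ∉ I ∧ f (insert k (I \ {i})) + g B ≤ f I + g (insert k (B \ {i})) := by
  classical
  let x : α → WithTop Γ := fun k ↦ if k ∈ I \ {i} then ⊤ else f (insert k (I \ {i}))
  have hxi : x i = f I := by simp [x, insert_eq_of_mem hi]
  have hx {k : α} (hk : k ∉ I \ {i}) : x k = f (insert k (I \ {i})) := if_neg hk
  obtain ⟨B, hB, hiB, hle⟩ := exists_mem_forall_exchange_le hg hne hfin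
      (lexOfWithTop ∘ g) (lexOfWithTop ∘ x) (i := i) fun B hB hiB ↦ by
    obtain ⟨k, hk, -, hgk, hle⟩ := hfg.exists_exchange_ne_top hI hB ⟨hi, hiB⟩
    refine ⟨k, hk.1, hgk, (lexOfWithTop_add_le_iff hgk (hxi ▸ hI) hB).2 ?_⟩
    rwa [hx fun h ↦ hk.2 h.1, hxi]
  refine ⟨B, hB, hiB, fun k hk hgk ↦ ?_⟩
  have hle : x k + g B ≤ f I + g (insert k (B \ {i})) :=
    hxi ▸ (lexOfWithTop_add_le_iff hB (hxi ▸ hI) hgk).1 (hle k hk hgk)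
  have hxk : x k ≠ ⊤ :=
    (WithTop.add_ne_top.1 (ne_top_of_le_ne_top (WithTop.add_ne_top.2 ⟨hI, hgk⟩) hle)).1
  have hkI : k ∉ I \ {i} := fun h ↦ hxk (if_pos h)
  exact ⟨fun h ↦ hkI ⟨h, fun hki ↦ hk (hki ▸ hiB)⟩, hx hkI ▸ hle⟩

theorem trans (hfg : QuotientExchange f g) (hgh : QuotientExchange g h)
    (hg : {B | g B ≠ ⊤}.Finite) (hne : {B | g B ≠ ⊤}.Nonempty)
    (hfin : ∀ B, g B ≠ ⊤ → B.Finite) : QuotientExchange f h := by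
  intro I J hI hJ i hi
  obtain ⟨B, hB, hiB, hBI⟩ := hfg.exists_forall_exchange_le hg hne hfin hI hi.1
  obtain ⟨j, hj, hgj, -, hle⟩ := hgh.exists_exchange_ne_top hB hJ ⟨hiB, hi.2⟩
  obtain ⟨hjI, hle'⟩ := hBI j hj.2 hgj
  refine ⟨j, ⟨hj.1, hjI⟩, ?_⟩
  refine (WithTop.add_le_add_iff_right (WithTop.add_ne_top.2 ⟨hB, hgj⟩)).1 ?_
  calc f (insert j (I \ {i})) + h (insert i (J \ {j})) + (g B + g (insert j (B \ {i})))
      = (f (insert j (I \ {i})) + g B) + (g (insert j (B \ {i})) + h (insert i (J \ {j}))) := by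
        abel
    _ ≤ (f I + g (insert j (B \ {i}))) + (g B + h J) := add_le_add hle' hle
    _ = f I + h J + (g B + g (insert j (B \ {i}))) := by abel

end QuotientExchange

section Matroid

variable {α : Type*}

theorem eRk_add_eRk_le_of_closure_subset_closure {M N : Matroid α} (hE : M.E = N.E)
    (h : ∀ X, N.closure X ⊆ M.closure X) {A B : Set α} (hAB : A ⊆ B) :
    M.eRk B + N.eRk A ≤ M.eRk A + N.eRk B := by
  obtain ⟨K, hK⟩ := N.exists_isBasis' A
  obtain ⟨L, hL, hKL⟩ := hK.indep.subset_isBasis'_of_subset (hK.subset.trans hAB)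
  have hAL : A ∪ L = A ∪ (L \ K) := by
    rw [← union_sdiff_cancel hKL, ← union_assoc, union_eq_self_of_subset_right hK.subset,
      union_sdiff_cancel_left (inter_sdiff_self K L).subset]
  have hB : B ∩ M.E ⊆ M.closure (A ∪ (L \ K)) := calc
    B ∩ M.E ⊆ N.closure L := by
      rw [hE, hL.closure_eq_closure]
      exact N.inter_ground_subset_closure B
    _ ⊆ N.closure (A ∪ (L \ K)) := N.closure_subset_closure (hAL ▸ subset_union_right)
    _ ⊆ M.closure (A ∪ (L \ K)) := h _
  calc M.eRk B + N.eRk A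
      ≤ M.eRk (A ∪ (L \ K)) + K.encard := by
        rw [hK.encard_eq_eRk, ← M.eRk_inter_ground B, ← M.eRk_closure_eq (A ∪ (L \ K))]
        gcongr
        exact M.eRk_mono hB
    _ ≤ M.eRk A + (L \ K).encard + K.encard := by
        gcongr
        exact M.eRk_union_le_eRk_add_encard _ _
    _ = M.eRk A + N.eRk B := by
        rw [add_assoc, encard_sdiff_add_encard_of_subset hKL, hL.encard_eq_eRk]

theorem isQuotientOf_of_eRk_add_eRk_le {M N : Matroid α} [M.RankFinite] [N.RankFinite]
    (hE : M.E = N.E)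
    (h : ∀ A B, A ⊆ B → M.eRk B + N.eRk A ≤ M.eRk A + N.eRk B) : M.IsQuotientOf N := by
  refine ⟨hE, fun A B hAB _ ↦ ?_⟩
  have cast_toNat (P : Matroid α) [P.RankFinite] (X : Set α) : ((P.eRk X).toNat : ℕ∞) = P.eRk X :=
    ENat.natCast_toNat (Matroid.eRk_ne_top_iff.2 (P.isRkFinite_set X))
  have hle := h A B hAB
  rw [← cast_toNat M A, ← cast_toNat M B, ← cast_toNat N A, ← cast_toNat N B] at hle
  norm_cast at hle
  unfold Matroid.intRk
  omega

theorem eRank_contract_add_eRk (M : Matroid α) (S : Set α) :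
    (M.contract S).eRank + M.eRk S = M.eRank := by
  obtain ⟨K, hK⟩ := M.exists_isBasis' S
  obtain ⟨I, hI⟩ := (M.contract S).exists_isBase
  obtain ⟨hIS, hIK⟩ := (hK.isBase_contract_iff I).1 hI
  rw [← hI.encard_eq_eRank, ← hK.encard_eq_eRk, ← hIK.encard_eq_eRank,
    encard_union_eq (hIS.mono_right hK.subset)]

theorem eRank_delete_eq (M : Matroid α) (S : Set α) : (M.delete S).eRank = M.eRk (M.E \ S) := by
  rw [Matroid.delete_eq_restrict, Matroid.eRank_restrict]

theorem eRank_contract_le_eRank_delete (M : Matroid α) (S : Set α) :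
    (M.contract S).eRank ≤ (M.delete S).eRank := by
  obtain ⟨I, hI⟩ := (M.contract S).exists_isBase
  rw [← hI.encard_eq_eRank, eRank_delete_eq]
  exact hI.indep.of_contract.encard_le_eRk_of_subset hI.subset_ground

theorem subset_of_isBase_contract_ground_sdiff {M : Matroid α} {S L : Set α}
    (hL : (M.contract (M.E \ S)).IsBase L) : L ⊆ S :=
  hL.subset_ground.trans (sdiff_sdiff_right_self.trans_subset inter_subset_right)

end Matroid

namespace ValuatedMatroid

variable {α : Type*}

theorem maximal_traces_of_isBasis' (μ : ValuatedMatroid α) {S K : Set α}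
    (hK : μ.matroid.IsBasis' K S) : Maximal (· ∈ traces μ.val S) K := by
  have eq_trace {B : Set α} (hB : μ.matroid.IsBase B) (hKB : K ⊆ B ∩ S) : K = B ∩ S :=
    hK.eq_of_subset_indep (hB.indep.subset inter_subset_left) hKB inter_subset_right
  constructor
  · obtain ⟨B, hB, hKB⟩ := hK.indep.exists_isBase_superset
    exact ⟨B, (μ.val_ne_top_iff B).2 hB, (eq_trace hB (subset_inter hKB hK.subset)).symm⟩
  · rintro _ ⟨B, hB, rfl⟩ hKB
    exact (eq_trace ((μ.val_ne_top_iff B).1 hB) hKB).symm.subset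

theorem minimal_traces_of_isBase_contract (μ : ValuatedMatroid α) {S L : Set α}
    (hL : (μ.matroid.contract (μ.matroid.E \ S)).IsBase L) :
    Minimal (· ∈ traces μ.val S) L := by
  have hLS : L ⊆ S := subset_of_isBase_contract_ground_sdiff hL
  have isBase_union {J : Set α} (hJ : μ.matroid.IsBasis J (μ.matroid.E \ S)) :
      μ.matroid.IsBase (L ∪ J) :=
    ((hJ.isBasis'.isBase_contract_iff L).1 hL).2
  constructor
  · obtain ⟨J, hJ⟩ := μ.matroid.exists_isBasis (μ.matroid.E \ S)
    have hJS : Disjoint J S := disjoint_sdiff_left.mono_left hJ.subset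
    refine ⟨L ∪ J, (μ.val_ne_top_iff _).2 (isBase_union hJ), ?_⟩
    change (L ∪ J) ∩ S = L
    rw [union_inter_distrib_right, hJS.inter_eq, union_empty, inter_eq_left.2 hLS]
  · rintro _ ⟨B, hB, rfl⟩ hBL
    replace hB := (μ.val_ne_top_iff B).1 hB
    obtain ⟨J, hJ, hBJ⟩ := (hB.indep.sdiff S).subset_isBasis_of_subset
      (sdiff_subset_sdiff_left hB.subset_ground)
    have hBLJ : B = L ∪ J := hB.eq_of_subset_isBase (isBase_union hJ) <| by
      rw [← inter_union_sdiff B S]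
      exact union_subset_union hBL hBJ
    exact subset_inter (hBLJ ▸ subset_union_left) hLS

theorem exists_contract_val_eq (μ : ValuatedMatroid α) (S : Set α) :
    ∃ K ⊆ S, Maximal (· ∈ traces μ.val S) K ∧ (μ.contract S).val = sliceVal μ.val S K :=
  have hK := (μ.matroid.exists_isBasis' S).choose_spec
  ⟨_, hK.subset, μ.maximal_traces_of_isBasis' hK, rfl⟩

theorem exists_delete_val_eq (μ : ValuatedMatroid α) (S : Set α) :
    ∃ L ⊆ S, Minimal (· ∈ traces μ.val S) L ∧ (μ.delete S).val = sliceVal μ.val S L :=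
  have hL := (μ.matroid.contract (μ.matroid.E \ S)).exists_isBase.choose_spec
  ⟨_, subset_of_isBase_contract_ground_sdiff hL, μ.minimal_traces_of_isBase_contract hL, rfl⟩

theorem quotientExchange_self (μ : ValuatedMatroid α) : QuotientExchange μ.val μ.val :=
  fun I J hI hJ ↦ μ.exchange I J ((μ.val_ne_top_iff I).1 hI) ((μ.val_ne_top_iff J).1 hJ)

theorem isQuotient_iff {μ ν : ValuatedMatroid α} :
    μ.IsQuotient ν ↔ μ.matroid.E = ν.matroid.E ∧ μ.matroid.eRank ≤ ν.matroid.eRank ∧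
      QuotientExchange μ.val ν.val := by
  simp only [IsQuotient, QuotientExchange, E, val_ne_top_iff]

theorem finite_val_ne_top (μ : ValuatedMatroid α) : {B | μ.val B ≠ ⊤}.Finite :=
  μ.finite_ground.finite_subsets.subset fun B hB ↦ ((μ.val_ne_top_iff B).1 hB).subset_ground

theorem nonempty_val_ne_top (μ : ValuatedMatroid α) : {B | μ.val B ≠ ⊤}.Nonempty :=
  μ.matroid.exists_isBase.imp fun B ↦ (μ.val_ne_top_iff B).2

theorem finite_of_val_ne_top (μ : ValuatedMatroid α) {B : Set α} (hB : μ.val B ≠ ⊤) : B.Finite :=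
  μ.finite_ground.subset ((μ.val_ne_top_iff B).1 hB).subset_ground

instance (μ : ValuatedMatroid α) : μ.matroid.Finite := ⟨μ.finite_ground⟩

theorem contract_quotientExchange_delete (μ : ValuatedMatroid α) (S : Set α) :
    QuotientExchange (μ.contract S).val (μ.delete S).val := by
  obtain ⟨K, hKS, hK, hKval⟩ := μ.exists_contract_val_eq S
  obtain ⟨L, hLS, -, hLval⟩ := μ.exists_delete_val_eq S
  rw [hKval, hLval]
  exact μ.quotientExchange_self.sliceVal hKS hLS (.inl hK)

theorem contract_isQuotient_delete (μ : ValuatedMatroid α) (S : Set α) :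
    (μ.contract S).IsQuotient (μ.delete S) :=
  isQuotient_iff.2 ⟨rfl, eRank_contract_le_eRank_delete μ.matroid S,
    μ.contract_quotientExchange_delete S⟩

namespace IsQuotient

variable {μ ν ξ : ValuatedMatroid α}

theorem quotientExchange (h : μ.IsQuotient ν) : QuotientExchange μ.val ν.val :=
  (isQuotient_iff.1 h).2.2

theorem quotientExchange_contract (h : μ.IsQuotient ν) (S : Set α) :
    QuotientExchange (μ.contract S).val (ν.contract S).val := by
  obtain ⟨K, hKS, hK, hKval⟩ := μ.exists_contract_val_eq S
  obtain ⟨L, hLS, -, hLval⟩ := ν.exists_contract_val_eq S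
  rw [hKval, hLval]
  exact h.quotientExchange.sliceVal hKS hLS (.inl hK)

theorem quotientExchange_delete (h : μ.IsQuotient ν) (S : Set α) :
    QuotientExchange (μ.delete S).val (ν.delete S).val := by
  obtain ⟨K, hKS, -, hKval⟩ := μ.exists_delete_val_eq S
  obtain ⟨L, hLS, hL, hLval⟩ := ν.exists_delete_val_eq S
  rw [hKval, hLval]
  exact h.quotientExchange.sliceVal hKS hLS (.inr hL)

theorem closure_subset_closure (h : μ.IsQuotient ν) (X : Set α) :
    ν.matroid.closure X ⊆ μ.matroid.closure X := by
  intro e heν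
  by_contra heμ
  have heE : e ∈ μ.matroid.E := h.1.symm.subset (ν.matroid.mem_ground_of_mem_closure heν)
  have heX : e ∉ X := fun heX ↦ heμ (μ.matroid.mem_closure_of_mem' heX heE)
  have hloop : (ν.matroid.contract X).IsLoop e :=
    Matroid.contract_isLoop_iff_mem_closure.2 ⟨heν, heX⟩
  have hnonloop : (μ.matroid.contract X).IsNonloop e :=
    Matroid.contract_isNonloop_iff.2 ⟨heE, heμ⟩
  obtain ⟨I, hI, heI⟩ := hnonloop.exists_mem_isBase
  obtain ⟨J, hJ⟩ := (ν.matroid.contract X).exists_isBase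
  have heJ : e ∉ J := fun heJ ↦ (hJ.indep.isNonloop_of_mem heJ).not_isLoop hloop
  obtain ⟨j, -, -, hJ', -⟩ := (h.quotientExchange_contract X).exists_exchange_ne_top
    (((μ.contract X).val_ne_top_iff I).2 hI) (((ν.contract X).val_ne_top_iff J).2 hJ) ⟨heI, heJ⟩
  have hJ'_base : (ν.matroid.contract X).IsBase (insert e (J \ {j})) :=
    ((ν.contract X).val_ne_top_iff _).1 hJ'
  exact (hJ'_base.indep.isNonloop_of_mem (mem_insert _ _)).not_isLoop hloop

theorem eRk_add_eRk_le (h : μ.IsQuotient ν) {A B : Set α} (hAB : A ⊆ B) :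
    μ.matroid.eRk B + ν.matroid.eRk A ≤ μ.matroid.eRk A + ν.matroid.eRk B :=
  eRk_add_eRk_le_of_closure_subset_closure h.1 h.closure_subset_closure hAB

theorem isQuotientOf (h : μ.IsQuotient ν) : μ.matroid.IsQuotientOf ν.matroid :=
  isQuotientOf_of_eRk_add_eRk_le h.1 fun _ _ ↦ h.eRk_add_eRk_le

theorem trans (hμν : μ.IsQuotient ν) (hνξ : ν.IsQuotient ξ) : μ.IsQuotient ξ :=
  isQuotient_iff.2 ⟨hμν.1.trans hνξ.1, hμν.2.1.trans hνξ.2.1,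
    hμν.quotientExchange.trans hνξ.quotientExchange ν.finite_val_ne_top ν.nonempty_val_ne_top
      fun _ ↦ ν.finite_of_val_ne_top⟩

theorem eRank_contract_le (h : μ.IsQuotient ν) (S : Set α) :
    (μ.matroid.contract S).eRank ≤ (ν.matroid.contract S).eRank := by
  have hμ : μ.matroid.eRk S ≠ ⊤ := Matroid.eRk_ne_top_iff.2 (μ.matroid.isRkFinite_set S)
  have hν : ν.matroid.eRk S ≠ ⊤ := Matroid.eRk_ne_top_iff.2 (ν.matroid.isRkFinite_set S)
  have hle := h.eRk_add_eRk_le (subset_univ S)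
  rw [Matroid.eRk_univ_eq, Matroid.eRk_univ_eq, ← eRank_contract_add_eRk μ.matroid S,
    ← eRank_contract_add_eRk ν.matroid S, add_assoc, add_left_comm,
    ENat.add_le_add_iff_left hμ, ENat.add_le_add_iff_right hν] at hle
  exact hle

theorem eRank_delete_le (h : μ.IsQuotient ν) (S : Set α) :
    (μ.matroid.delete S).eRank ≤ (ν.matroid.delete S).eRank := by
  have hE : μ.matroid.E = ν.matroid.E := h.1
  rw [eRank_delete_eq, eRank_delete_eq, ← hE]
  simpa only [Matroid.eRk_empty, add_zero, zero_add] using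
    h.eRk_add_eRk_le (empty_subset (μ.matroid.E \ S))

theorem contract (h : μ.IsQuotient ν) (S : Set α) : (μ.contract S).IsQuotient (ν.contract S) :=
  isQuotient_iff.2 ⟨congrArg (· \ S) h.1, h.eRank_contract_le S, h.quotientExchange_contract S⟩

theorem delete (h : μ.IsQuotient ν) (S : Set α) : (μ.delete S).IsQuotient (ν.delete S) :=
  isQuotient_iff.2 ⟨congrArg (· \ S) h.1, h.eRank_delete_le S, h.quotientExchange_delete S⟩

end IsQuotient

end ValuatedMatroid

theorem mainTheorem9 {α : Type*} (μ ν ξ : ValuatedMatroid α) :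
    -- composition: if `ν` is a quotient of `μ` and `ξ` of `ν`, then `ξ` is a quotient of `μ`
    (ν.IsQuotient μ → ξ.IsQuotient ν → ξ.IsQuotient μ) ∧
    -- contraction and deletion preserve quotients
    (μ.IsQuotient ν → ∀ S : Set α, S ⊆ μ.E →
      (μ.contract S).IsQuotient (ν.contract S) ∧ (μ.delete S).IsQuotient (ν.delete S)) ∧
    -- the contraction is a quotient of the deletion
    (∀ S : Set α, S ⊆ μ.E → (μ.contract S).IsQuotient (μ.delete S)) ∧
    -- the underlying matroids form a matroid quotient
    (μ.IsQuotient ν → μ.matroid.IsQuotientOf ν.matroid) :=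
  ⟨fun hνμ hξν ↦ hξν.trans hνμ, fun h S _ ↦ ⟨h.contract S, h.delete S⟩,
    fun S _ ↦ μ.contract_isQuotient_delete S, fun h ↦ h.isQuotientOf⟩
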